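/- Let $k$ be a field. Consider the free nonsymmetric operad over $k$ generated by two binary operations $x(\ast\,\ast)$ and $y(\ast\,\ast)$, written $x(x_1\,x_2)=x_1\prec x_2$ and $y(x_1\,x_2)=x_1\succ x_2$. Its component of arity $m$ has as a basis the tree monomials of arity $m$, i.e. the planar binary trees with $m$ leaves (denoted $\ast$) whose internal vertices are labelled by $x$ or $y$. Let $I$ be the operadic ideal generated by the two defining relations of the nonsymmetric bicommutative operad $\mathrm{noncom}\text{-}\mathrm{Bicom}$, $$x_1\succ(x_2\prec x_3)-(x_1\succ x_2)\prec x_3,\qquad x_1\prec(x_2\succ x_3)-(x_1\prec x_2)\succ x_3,$$ so that $\mathrm{noncom}\text{-}\mathrm{Bicom}$ is the quotient of the free operad by $I$. For $n\ge 0$ let $f_n$ and $g_n$ be the rewriting rules of arity $n+3$ $$f_n:\quad x\bigl(\ast\,\underbrace{x(x(\cdots x}_{n}(y(\ast\,\ast)\,\ast)\cdots)\,\ast)\bigr)\;\rightarrow\;\underbrace{x(x(\cdots x}_{n}(y(x(\ast\,\ast)\,\ast)\,\ast)\cdots)\,\ast),$$ $$g_n:\quad y\bigl(\ast\,\underbrace{y(y(\cdots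 y}_{n}(x(\ast\,\ast)\,\ast)\cdots)\,\ast)\bigr)\;\rightarrow\;\underbrace{y(y(\cdots y}_{n}(x(y(\ast\,\ast)\,\ast)\,\ast)\cdots)\,\ast),$$ each identified with the element (left-hand side) $-$ (right-hand side) of the free operad. A monomial order is a well-order on the tree monomials of each arity such that all partial compositions are strictly increasing in each argument. Then there exists a monomial order for which the left-hand side of every $f_n$ and every $g_n$ ($n\ge 0$) is its leading monomial. Moreover, for every such monomial order, the set $S=\{f_n,g_n\mid n\ge 0\}$ is a Gröbner basis of $I$: $S\subseteq I$, and for every $m$ the leading monomial of every nonzero element of $I$ of arity $m$ is divisible by (i.e. contains, as a labelled planar subtree whose leaves may be continued by arbitrary trees) the leading monomial of some element of $S$. -/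

import Mathlib

noncomputable section

namespace NSOperad

/-- TreeMonomial monomials on a set `X` of binary generators: planar binary trees whose internal vertices
are labelled by elements of `X`. The tree `leaf` is the unit of the operad. -/
inductive TreeMonomial (X : Type) : Type
  | leaf : TreeMonomial X
  | node : X → TreeMonomial X → TreeMonomial X → TreeMonomial X

namespace TreeMonomial

variable {X : Type}

/-- The arity of a tree monomial: its number of leaves. -/
def arity : TreeMonomial X → ℕ
  | leaf => 1
  | node _ l r => l.arity + r.arity

/-- The partial composition `t ∘ᵢ s` of tree monomials: `s` is grafted at the `i`-th leaf of `t`.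
Leaves are numbered from left to right, starting with `0`; only `i < t.arity` is meaningful. -/
def graft : TreeMonomial X → ℕ → TreeMonomial X → TreeMonomial X
  | leaf, _, s => s
  | node a l r, i, s =>
      if i < l.arity then node a (l.graft i s) r else node a l (r.graft (i - l.arity) s)

theorem arity_pos (t : TreeMonomial X) : 0 < t.arity := by
  induction t with
  | leaf => simp [arity]
  | node a l r hl hr => simp only [arity]; omega

theorem arity_graft (t s : TreeMonomial X) (i : ℕ) :
    (t.graft i s).arity = t.arity + s.arity - 1 := by
  induction t generalizing i with
  | leaf => simp [arity, graft]
  | node a l r hl hr =>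
    have h1 := l.arity_pos
    have h2 := r.arity_pos
    simp only [graft]
    split_ifs
    · simp only [arity, hl]; omega
    · simp only [arity, hr]; omega

/-- `MatchesRoot s t`: the tree `s` is an upper part of `t` containing the root of `t`, that is,
`t` arises from `s` by grafting trees at the leaves of `s`. -/
inductive MatchesRoot : TreeMonomial X → TreeMonomial X → Prop
  | leaf (t : TreeMonomial X) : MatchesRoot leaf t
  | node (a : X) {l r l' r' : TreeMonomial X} :
      MatchesRoot l l' → MatchesRoot r r' → MatchesRoot (node a l r) (node a l' r')

/-- Divisibility of tree monomials: `s` occurs in `t` as a (connected, labelled, planar)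
subtree, the root of the occurrence being any vertex of `t`. -/
inductive Divides (s : TreeMonomial X) : TreeMonomial X → Prop
  | root {t : TreeMonomial X} : MatchesRoot s t → Divides s t
  | left (a : X) {l : TreeMonomial X} (r : TreeMonomial X) : Divides s l → Divides s (node a l r)
  | right (a : X) (l : TreeMonomial X) {r : TreeMonomial X} : Divides s r → Divides s (node a l r)

end TreeMonomial

/-- A monomial order on tree monomials: for every arity, a well-order of the
tree monomials of that arity, such that the partial compositions are strictly increasing in each
argument. (Values of `lt` on trees of different arities play no role.) -/
structure TreeMonomialOrder (X : Type) where
  lt : TreeMonomial X → TreeMonomial X → Prop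
  isWellOrder : ∀ n : ℕ,
    IsWellOrder {t : TreeMonomial X // t.arity = n} (fun s t => lt s.1 t.1)
  graft_left : ∀ (s s' t : TreeMonomial X) (i : ℕ), s.arity = s'.arity → i < s.arity →
    lt s s' → lt (s.graft i t) (s'.graft i t)
  graft_right : ∀ (s t t' : TreeMonomial X) (i : ℕ), t.arity = t'.arity → i < s.arity →
    lt t t' → lt (s.graft i t) (s.graft i t')

/-- The total space of the free nonsymmetric operad on the set `X` of binary generators over `k`:
linear combinations of tree monomials. -/
abbrev Free (k : Type*) (X : Type) [Field k] : Type _ := TreeMonomial X →₀ k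

variable {k : Type*} {X : Type} [Field k]

/-- The component of arity `n` of the free nonsymmetric operad. -/
def component (k : Type*) (X : Type) [Field k] (n : ℕ) : Submodule k (Free k X) :=
  Finsupp.supported k k {t : TreeMonomial X | t.arity = n}

/-- The partial composition `f ∘ᵢ g`, the bilinear extension of grafting. -/
def pcomp (f : Free k X) (i : ℕ) (g : Free k X) : Free k X :=
  f.sum fun s a => g.sum fun t b => Finsupp.single (s.graft i t) (a * b)

/-- Ideals of the free nonsymmetric operad: families of subspaces of the components that are
closed under partial compositions, on either side, with arbitrary elements. -/
structure IsOperadIdeal (I : ℕ → Submodule k (Free k X)) : Prop where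
  le_component : ∀ n, I n ≤ component k X n
  comp_left : ∀ (m n i : ℕ) (f g : Free k X), i < m → f ∈ I m → g ∈ component k X n →
    pcomp f i g ∈ I (m + n - 1)
  comp_right : ∀ (m n i : ℕ) (f g : Free k X), i < m → f ∈ component k X m → g ∈ I n →
    pcomp f i g ∈ I (m + n - 1)

/-- The ideal generated by a set `R` of (arity-homogeneous) elements, as the intersection
of all ideals containing `R`; the value at `n` is its component of arity `n`. -/
def idealSpan (R : Set (Free k X)) (n : ℕ) : Submodule k (Free k X) :=
  sInf {J | ∃ I : ℕ → Submodule k (Free k X), IsOperadIdeal I ∧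
    (∀ r ∈ R, ∀ m, r ∈ component k X m → r ∈ I m) ∧ J = I n}

/-- `t` is the leading (largest) monomial of `f`. -/
def IsLeadingMonomial (o : TreeMonomialOrder X) (f : Free k X) (t : TreeMonomial X) : Prop :=
  t ∈ f.support ∧ ∀ s ∈ f.support, s ≠ t → o.lt s t

/-- `G` is a Gröbner basis of the ideal `I`: `G` consists of elements of `I`, and the leading
monomial of every nonzero element of `I` is divisible by the leading monomial of an element
of `G`. -/
def IsGroebnerBasis (o : TreeMonomialOrder X) (G : Set (Free k X))
    (I : ℕ → Submodule k (Free k X)) : Prop :=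
  (∀ g ∈ G, ∃ n, g ∈ I n) ∧
    ∀ (n : ℕ) (f : Free k X), f ∈ I n → f ≠ 0 →
      ∃ g ∈ G, ∃ s t : TreeMonomial X, IsLeadingMonomial o g s ∧ IsLeadingMonomial o f t ∧ s.Divides t

/-- The two generating operations: `x` stands for `x₁ ≺ x₂` and `y` for `x₁ ≻ x₂`. -/
inductive Op : Type
  | x : Op
  | y : Op

open TreeMonomial Op

/-- The defining relations of the nonsymmetric bicommutative operad:
`x₁ ≻ (x₂ ≺ x₃) = (x₁ ≻ x₂) ≺ x₃` and `x₁ ≺ (x₂ ≻ x₃) = (x₁ ≺ x₂) ≻ x₃`. -/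
def bicomRelations (k : Type*) [Field k] : Set (Free k Op) :=
  {Finsupp.single (node y leaf (node x leaf leaf)) 1
      - Finsupp.single (node x (node y leaf leaf) leaf) 1,
   Finsupp.single (node x leaf (node y leaf leaf)) 1
      - Finsupp.single (node y (node x leaf leaf) leaf) 1}

/-- The ideal of relations of the nonsymmetric bicommutative operad, which is the
quotient of the free nonsymmetric operad on `x`, `y` by this ideal. -/
def bicomIdeal (k : Type*) [Field k] : ℕ → Submodule k (Free k Op) :=
  idealSpan (bicomRelations k)

/-- `a(a(⋯ a(t *) ⋯ *) *)` with `n` letters `a`. -/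
def leftComb (a : Op) (n : ℕ) (t : TreeMonomial Op) : TreeMonomial Op :=
  (fun s => node a s leaf)^[n] t

/-- The tree `a(* a(a(⋯ a(b(* *) *) ⋯ ) *))` with `n` letters `a` after the first one. -/
def ruleLhs (a b : Op) (n : ℕ) : TreeMonomial Op :=
  node a leaf (leftComb a n (node b leaf leaf))

/-- The tree `a(a(⋯ a(b(a(* *) *) *) ⋯ ) *)` with `n` letters `a` before `b`. -/
def ruleRhs (a b : Op) (n : ℕ) : TreeMonomial Op :=
  leftComb a n (node b (node a leaf leaf) leaf)

/-- The element `lhs - rhs` of the free operad given by the rule `lhs → rhs`. -/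
def ruleElement (k : Type*) [Field k] (a b : Op) (n : ℕ) : Free k Op :=
  Finsupp.single (ruleLhs a b n) 1 - Finsupp.single (ruleRhs a b n) 1

/-- The rewriting rule `fₙ`. -/
def bicomF (k : Type*) [Field k] (n : ℕ) : Free k Op := ruleElement k x y n

/-- The rewriting rule `gₙ`. -/
def bicomG (k : Type*) [Field k] (n : ℕ) : Free k Op := ruleElement k y x n

/-- In every rule `fₙ`, `gₙ` the left-hand side is the leading monomial. -/
def OrientsRules (k : Type*) [Field k] (o : TreeMonomialOrder Op) : Prop :=
  ∀ n : ℕ, IsLeadingMonomial o (bicomF k n) (ruleLhs x y n) ∧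
    IsLeadingMonomial o (bicomG k n) (ruleLhs y x n)

end NSOperad

end

/-! Confluence is not checked through S-polynomials; an explicit normal form replaces them. The map
`nf` evaluates a tree with x and y interpreted by `mul`, and `mul` satisfies the two bicommutative
relations exactly (`mul_mul`). So `nf` is constant on classes of the congruence `Cong`, and its
linear extension vanishes on I (`bicomIdeal_le_nfKernel`). Conversely every tree is congruent to its
normal form (`cong_nf`), so both sides of a rule, having the same normal form, are congruent, and
their difference lies in I.

A tree containing no left-hand side is its own normal form (`nf_eq_self`). If an order orients the
rules, then nf t ≤ t, because `mul` amounts to a chain of rule applications (`nf_eq_or_below`).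
Suppose the leading monomial t of some f in I contained no left-hand side. Then nf t = t, while
every other s in the support has nf s ≤ s < t. So nf(f) has at t the nonzero coefficient of t in f,
against nf(f) = 0.

An orienting order compares leaf depths lexicographically from right to left, then labels: the
rightmost leaf has depth 2 in every left-hand side and depth 1 in every right-hand side. -/

noncomputable section

namespace NSOperad

open TreeMonomial Op

/-! ### Normal forms and the bicommutative congruence -/

section NormalForm

/-- All labels on the left spine of the tree are equal to `a`. -/
def SpineAll (a : Op) : TreeMonomial Op → Prop
  | leaf => True
  | node b l _ => b = a ∧ SpineAll a l

open Classical in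
/-- The product of `A` and `R` by the operation `a`: the vertex `a` with left subtree `A` is inserted
on the left spine of `R`, just below the last vertex with a label different from `a`. -/
def mul (a : Op) (A : TreeMonomial Op) : TreeMonomial Op → TreeMonomial Op
  | leaf => node a A leaf
  | node b l r => if SpineAll a (node b l r) then node a A (node b l r) else node b (mul a A l) r

theorem mul_of_spineAll {a : Op} (A : TreeMonomial Op) {R : TreeMonomial Op} (h : SpineAll a R) :
    mul a A R = node a A R := by
  cases R with
  | leaf => rfl
  | node b l r => rw [mul, if_pos h]

theorem mul_of_not_spineAll {a b : Op} (A : TreeMonomial Op) {l r : TreeMonomial Op}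
    (h : ¬ SpineAll a (node b l r)) : mul a A (node b l r) = node b (mul a A l) r := by
  rw [mul, if_neg h]

/-- The inserted b lies on the left spine, so a later `mul a` has to descend past it. -/
theorem not_spineAll_mul {a b : Op} (h : a ≠ b) (B C : TreeMonomial Op) :
    ¬ SpineAll a (mul b B C) := by
  induction C with
  | leaf => rintro ⟨h1, -⟩; exact h h1.symm
  | node c l r hl _ =>
    by_cases hs : SpineAll b (node c l r)
    · rw [mul_of_spineAll _ hs]; rintro ⟨h1, -⟩; exact h h1.symm
    · rw [mul_of_not_spineAll _ hs]; exact fun h1 => hl h1.2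

/-- Every spine vertex from the root of `mul b B C` down to the inserted b has a label other than a
at or below it. So `mul a A` descends to this b and continues in its left subtree, where it computes
`mul a A B`. -/
theorem mul_mul {a b : Op} (h : a ≠ b) (A B C : TreeMonomial Op) :
    mul a A (mul b B C) = mul b (mul a A B) C := by
  have key : ∀ C, mul a A (node b B C) = node b (mul a A B) C := fun C =>
    mul_of_not_spineAll _ fun h1 => h h1.1.symm
  induction C with
  | leaf => exact key _
  | node c l r hl _ =>
    by_cases hs : SpineAll b (node c l r)
    · rw [mul_of_spineAll _ hs, mul_of_spineAll _ hs, key]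
    · rw [mul_of_not_spineAll _ hs, mul_of_not_spineAll _ hs, mul_of_not_spineAll, hl]
      exact fun h1 => not_spineAll_mul h _ _ h1.2

/-- The normal form of a tree monomial. -/
def nf : TreeMonomial Op → TreeMonomial Op
  | leaf => leaf
  | node a l r => mul a (nf l) (nf r)

/-- The congruence on tree monomials generated by the bicommutative relations. -/
inductive Cong : TreeMonomial Op → TreeMonomial Op → Prop
  | refl (t) : Cong t t
  | symm {s t} : Cong s t → Cong t s
  | trans {s t u} : Cong s t → Cong t u → Cong s u
  | node (a) {l r l' r'} : Cong l l' → Cong r r' → Cong (node a l r) (node a l' r')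
  | rel {a b : Op} (h : a ≠ b) (A B C) : Cong (node a A (node b B C)) (node b (node a A B) C)

theorem Cong.arity_eq {s t : TreeMonomial Op} (h : Cong s t) : s.arity = t.arity := by
  induction h with
  | refl => rfl
  | symm _ ih => exact ih.symm
  | trans _ _ h1 h2 => exact h1.trans h2
  | node a _ _ h1 h2 => simp only [arity, h1, h2]
  | rel => simp only [arity, Nat.add_assoc]

theorem Cong.nf_eq {s t : TreeMonomial Op} (h : Cong s t) : nf s = nf t := by
  induction h with
  | refl => rfl
  | symm _ ih => exact ih.symm
  | trans _ _ h1 h2 => exact h1.trans h2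
  | node a _ _ h1 h2 => simp only [nf, h1, h2]
  | rel h => simp only [nf, mul_mul h]

theorem Cong.graft_right (s : TreeMonomial Op) (i : ℕ) {t t' : TreeMonomial Op} (h : Cong t t') :
    Cong (s.graft i t) (s.graft i t') := by
  induction s generalizing i with
  | leaf => exact h
  | node a l r hl hr =>
    simp only [graft]
    split_ifs
    · exact .node a (hl i) (.refl r)
    · exact .node a (.refl l) (hr _)

theorem Cong.graft_left {s s' : TreeMonomial Op} (h : Cong s s') (i : ℕ) (t : TreeMonomial Op) :
    Cong (s.graft i t) (s'.graft i t) := by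
  induction h generalizing i with
  | refl => exact .refl _
  | symm _ ih => exact .symm (ih i)
  | trans _ _ h1 h2 => exact .trans (h1 i) (h2 i)
  | node a hl hr h1 h2 =>
    simp only [graft, hl.arity_eq]
    split_ifs
    · exact .node a (h1 i) hr
    · exact .node a hl (h2 _)
  | rel h A B C =>
    simp only [graft, arity, Nat.sub_sub]
    split_ifs <;> first | omega | exact .rel h _ _ _

/-- Read backwards, the relation turns a(b(P Q) r) into b(P a(Q r)), which lifts a label b ≠ a along
the spine to the root. -/
theorem exists_cong_node_of_not_spineAll {a : Op} {L : TreeMonomial Op} (h : ¬ SpineAll a L) :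
    ∃ b P Q, a ≠ b ∧ Cong L (node b P Q) := by
  induction L with
  | leaf => exact absurd trivial h
  | node c l r hl _ =>
    by_cases hc : c = a
    · subst hc
      obtain ⟨b, P, Q, hb, hPQ⟩ := hl fun h1 => h ⟨rfl, h1⟩
      exact ⟨b, P, node c Q r, hb, (Cong.node c hPQ (.refl r)).trans (.symm (.rel hb.symm _ _ _))⟩
    · exact ⟨c, l, r, Ne.symm hc, .refl _⟩

/-- Passing a vertex with a different label is a single relation. Passing one with the same label
needs a differently labelled vertex further down the spine as a catalyst. -/
theorem cong_mul (a : Op) (A R : TreeMonomial Op) : Cong (node a A R) (mul a A R) := by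
  induction R with
  | leaf => exact .refl _
  | node c l r hl _ =>
    by_cases hs : SpineAll a (node c l r)
    · rw [mul_of_spineAll _ hs]; exact .refl _
    · rw [mul_of_not_spineAll _ hs]
      refine .trans ?_ (.node c hl (.refl r))
      by_cases hc : c = a
      · subst hc
        obtain ⟨b, P, Q, hb, hPQ⟩ := exists_cong_node_of_not_spineAll fun h1 => hs ⟨rfl, h1⟩
        -- With l ~ b(P Q) the chain is c(A c(l r)) ~ c(A b(P c(Q r))) ~ b(c(A P) c(Q r)) ~ c(b(c(A
        -- P) Q) r) ~ c(c(A l) r).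
        have h1 : Cong (node c A (node c l r)) (node c A (node b P (node c Q r))) :=
          .node c (.refl A) ((Cong.node c hPQ (.refl r)).trans (.symm (.rel hb.symm _ _ _)))
        have h2 : Cong (node c (node b (node c A P) Q) r) (node c (node c A l) r) :=
          .node c ((Cong.rel hb A P Q).symm.trans (.node c (.refl A) hPQ.symm)) (.refl r)
        exact h1.trans ((Cong.rel hb _ _ _).trans ((Cong.rel hb.symm _ _ _).trans h2))
      · exact .rel (Ne.symm hc) _ _ _

theorem cong_nf (t : TreeMonomial Op) : Cong t (nf t) := by
  induction t with
  | leaf => exact .refl _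
  | node a l r hl hr => exact (Cong.node a hl hr).trans (cong_mul a _ _)

theorem nf_graft_nf_left (s : TreeMonomial Op) (i : ℕ) (t : TreeMonomial Op) :
    nf ((nf s).graft i t) = nf (s.graft i t) :=
  ((cong_nf s).graft_left i t).nf_eq.symm

theorem nf_graft_nf_right (s : TreeMonomial Op) (i : ℕ) (t : TreeMonomial Op) :
    nf (s.graft i (nf t)) = nf (s.graft i t) :=
  ((cong_nf t).graft_right s i).nf_eq.symm

theorem leftComb_succ (a : Op) (n : ℕ) (t : TreeMonomial Op) :
    leftComb a (n + 1) t = node a (leftComb a n t) leaf :=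
  Function.iterate_succ_apply' _ _ _

theorem arity_leftComb (a : Op) (n : ℕ) (t : TreeMonomial Op) :
    (leftComb a n t).arity = t.arity + n := by
  induction n with
  | zero => rfl
  | succ n ih => simp only [leftComb_succ, arity, ih, Nat.add_assoc]

/-- The b at the bottom of the spine lets the outer a slide past the n inner vertices a (`key`);
exchanging it with b is then one relation (`h2`). -/
theorem nf_ruleLhs {a b : Op} (h : a ≠ b) (n : ℕ) : nf (ruleLhs a b n) = nf (ruleRhs a b n) := by
  have key : ∀ t : TreeMonomial Op, ¬ SpineAll a (nf t) →
      nf (node a leaf (leftComb a n t)) = nf (leftComb a n (node a leaf t)) ∧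
        ¬ SpineAll a (nf (leftComb a n t)) := by
    intro t ht
    induction n with
    | zero => exact ⟨rfl, ht⟩
    | succ n ih =>
      have h1 : nf (leftComb a (n + 1) t) = node a (nf (leftComb a n t)) leaf := by
        rw [leftComb_succ]; rfl
      have h2 : ¬ SpineAll a (nf (leftComb a (n + 1) t)) := by
        rw [h1]; exact fun h => ih.2 h.2
      refine ⟨?_, h2⟩
      rw [h1] at h2
      rw [leftComb_succ a n (node a leaf t)]
      simp only [nf, h1]
      rw [mul_of_not_spineAll _ h2, ← ih.1]
      rfl
  have hb : nf (node b leaf leaf) = node b leaf leaf := rfl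
  have h1 := (key (node b leaf leaf) (by rw [hb]; exact fun h1 => h h1.1.symm)).1
  have h2 : Cong (leftComb a n (node a leaf (node b leaf leaf)))
      (leftComb a n (node b (node a leaf leaf) leaf)) := by
    clear h1 key
    induction n with
    | zero => exact .rel h _ _ _
    | succ n ih => simp only [leftComb_succ]; exact .node a ih (.refl _)
  exact h1.trans h2.nf_eq

theorem cong_rule {a b : Op} (h : a ≠ b) (n : ℕ) : Cong (ruleLhs a b n) (ruleRhs a b n) :=
  (cong_nf _).trans (by rw [nf_ruleLhs h]; exact (cong_nf _).symm)

end NormalForm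

/-! ### Trees without left-hand sides are normal -/

section Division

/-- The tree `a(⋯ a(a(T D₁) D₂) ⋯ Dₙ)`. -/
def comb (a : Op) (D : List (TreeMonomial Op)) (T : TreeMonomial Op) : TreeMonomial Op :=
  D.foldl (node a) T

theorem comb_concat (a : Op) (D : List (TreeMonomial Op)) (d T : TreeMonomial Op) :
    comb a (D ++ [d]) T = node a (comb a D T) d := by
  simp [comb]

theorem arity_le_arity_comb (a : Op) (D : List (TreeMonomial Op)) (T : TreeMonomial Op) :
    T.arity ≤ (comb a D T).arity := by
  induction D generalizing T with
  | nil => exact le_rfl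
  | cons d D ih => exact le_trans (by simp [arity]) (ih (node a T d))

theorem graft_comb (a : Op) (D : List (TreeMonomial Op)) (T t : TreeMonomial Op) {i : ℕ}
    (hi : i < T.arity) : (comb a D T).graft i t = comb a D (T.graft i t) := by
  induction D generalizing T with
  | nil => rfl
  | cons d D ih =>
    have h1 : (node a T d).graft i t = node a (T.graft i t) d := by rw [graft, if_pos hi]
    change (comb a D (node a T d)).graft i t = comb a D (node a (T.graft i t) d)
    rw [ih _ (by simp only [arity]; omega), h1]

/-- Cutting the left spine at its topmost label b ≠ a, with D the right subtrees above it, exhibits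
one round of `mul`: a rule applied at the root, then `mul a A B` deeper down. -/
theorem exists_comb_of_not_spineAll {a : Op} {R : TreeMonomial Op} (h : ¬ SpineAll a R) :
    ∃ D b B C, a ≠ b ∧ R = comb a D (node b B C) ∧
      ∀ A, mul a A R = comb a D (node b (mul a A B) C) := by
  induction R with
  | leaf => exact absurd trivial h
  | node c l r hl _ =>
    by_cases hc : c = a
    · subst hc
      obtain ⟨D, b, B, C, hb, h1, h2⟩ := hl fun h1 => h ⟨rfl, h1⟩
      refine ⟨D ++ [r], b, B, C, hb, ?_, fun A => ?_⟩
      · rw [comb_concat, ← h1]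
      · rw [comb_concat, mul_of_not_spineAll _ h, h2]
    · exact ⟨[], c, l, r, Ne.symm hc, rfl, fun A => mul_of_not_spineAll A h⟩

theorem matchesRoot_leftComb_comb {a : Op} {s t : TreeMonomial Op} (h : MatchesRoot s t)
    (D : List (TreeMonomial Op)) : MatchesRoot (leftComb a D.length s) (comb a D t) := by
  induction D using List.reverseRecOn with
  | nil => exact h
  | append_singleton D d ih =>
    rw [comb_concat, List.length_append, List.length_singleton, leftComb_succ]
    exact .node a ih (.leaf d)

/-- At a vertex a(l r), a label other than a on the left spine of r would complete a left-hand side,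
with n the number of a's above the first such label. So `mul` has nothing to move. -/
theorem nf_eq_self {t : TreeMonomial Op} (h : ∀ a b n, a ≠ b → ¬ (ruleLhs a b n).Divides t) :
    nf t = t := by
  induction t with
  | leaf => rfl
  | node a l r hl hr =>
    have h1 := hl fun a' b n hab hd => h a' b n hab (.left a r hd)
    have h2 := hr fun a' b n hab hd => h a' b n hab (.right a l hd)
    rw [nf, h1, h2]
    by_cases hs : SpineAll a r
    · exact mul_of_spineAll l hs
    · obtain ⟨D, b, B, C, hb, rfl, -⟩ := exists_comb_of_not_spineAll hs
      refine absurd (Divides.root ?_) (h a b D.length hb)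
      exact .node a (.leaf _)
        (matchesRoot_leftComb_comb (.node b (.leaf _) (.leaf _)) D)

end Division

/-! ### Normal forms do not increase in an orienting order -/

section Order

namespace TreeMonomialOrder

variable {X : Type} (o : TreeMonomialOrder X)

theorem lt_irrefl (s : TreeMonomial X) : ¬ o.lt s s := by
  have := o.isWellOrder s.arity
  exact irrefl_of (fun s' t : {t : TreeMonomial X // t.arity = s.arity} => o.lt s'.1 t.1) ⟨s, rfl⟩

theorem lt_trans {s t u : TreeMonomial X} (h1 : s.arity = t.arity) (h2 : t.arity = u.arity)
    (h : o.lt s t) (h' : o.lt t u) : o.lt s u := by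
  have := o.isWellOrder u.arity
  exact trans_of (fun s' t : {t : TreeMonomial X // t.arity = u.arity} => o.lt s'.1 t.1)
    (a := ⟨s, h1.trans h2⟩) (b := ⟨t, h2⟩) (c := ⟨u, rfl⟩) h h'

theorem lt_trichotomy {s t : TreeMonomial X} (h : s.arity = t.arity) :
    o.lt s t ∨ s = t ∨ o.lt t s := by
  have := o.isWellOrder t.arity
  have := trichotomous_of (fun s' t' : {t' : TreeMonomial X // t'.arity = t.arity} =>
    o.lt s'.1 t'.1) ⟨s, h⟩ ⟨t, rfl⟩
  simpa using this

/-- Two trees of the same arity with `s < t`. -/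
def Below (s t : TreeMonomial X) : Prop := s.arity = t.arity ∧ o.lt s t

variable {o}

theorem Below.trans {s t u : TreeMonomial X} (h : o.Below s t) (h' : o.Below t u) : o.Below s u :=
  ⟨h.1.trans h'.1, o.lt_trans h.1 h'.1 h.2 h'.2⟩

theorem Below.graft_left {s s' : TreeMonomial X} (h : o.Below s s') {i : ℕ} (hi : i < s.arity)
    (t : TreeMonomial X) : o.Below (s.graft i t) (s'.graft i t) :=
  ⟨by rw [arity_graft, arity_graft, h.1], o.graft_left _ _ _ _ h.1 hi h.2⟩

theorem Below.graft_right {t t' : TreeMonomial X} (h : o.Below t t') (s : TreeMonomial X) {i : ℕ}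
    (hi : i < s.arity) : o.Below (s.graft i t) (s.graft i t') :=
  ⟨by rw [arity_graft, arity_graft, h.1], o.graft_right _ _ _ _ h.1 hi h.2⟩

theorem Below.node_left {l l' : TreeMonomial X} (h : o.Below l l') (a : X) (r : TreeMonomial X) :
    o.Below (node a l r) (node a l' r) := by
  simpa [graft, arity] using h.graft_right (node a leaf r) (i := 0) (by simp [arity])

theorem Below.node_right {r r' : TreeMonomial X} (h : o.Below r r') (a : X) (l : TreeMonomial X) :
    o.Below (node a l r) (node a l r') := by
  simpa [graft, arity] using h.graft_right (node a l leaf) (i := l.arity) (by simp [arity])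

end TreeMonomialOrder

open TreeMonomialOrder

variable {k : Type*} [Field k] {o : TreeMonomialOrder Op}

theorem Below.comb {t t' : TreeMonomial Op} (h : o.Below t t') (a : Op)
    (D : List (TreeMonomial Op)) : o.Below (comb a D t) (comb a D t') := by
  induction D generalizing t t' with
  | nil => exact h
  | cons d D ih => exact ih (h.node_left a d)

theorem ruleLhs_ne_ruleRhs {a b : Op} (h : a ≠ b) (n : ℕ) : ruleRhs a b n ≠ ruleLhs a b n := by
  cases n with
  | zero => exact fun h1 => h (TreeMonomial.node.inj h1).1.symm
  | succ n =>
    rw [ruleRhs, leftComb_succ]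
    intro h1
    have h2 := congrArg TreeMonomial.arity (TreeMonomial.node.inj h1).2.1
    rw [arity_leftComb] at h2
    simp only [arity] at h2
    omega

theorem below_of_isLeadingMonomial {a b : Op} (h : a ≠ b) {n : ℕ}
    (hl : IsLeadingMonomial o (ruleElement k a b n) (ruleLhs a b n)) :
    o.Below (ruleRhs a b n) (ruleLhs a b n) := by
  refine ⟨(cong_rule h n).arity_eq.symm, hl.2 _ ?_ (ruleLhs_ne_ruleRhs h n)⟩
  simp [ruleElement, (ruleLhs_ne_ruleRhs h n).symm]

theorem OrientsRules.below (ho : OrientsRules k o) {a b : Op} (h : a ≠ b) (n : ℕ) :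
    o.Below (ruleRhs a b n) (ruleLhs a b n) := by
  cases a <;> cases b
  · exact absurd rfl h
  · exact below_of_isLeadingMonomial h (ho n).1
  · exact below_of_isLeadingMonomial h (ho n).2
  · exact absurd rfl h

/-- A rule applied at the root of a tree decreases it. -/
theorem below_rule_instance {a b : Op}
    (h : ∀ n, o.Below (ruleRhs a b n) (ruleLhs a b n)) (D : List (TreeMonomial Op))
    (A B C : TreeMonomial Op) :
    o.Below (comb a D (node b (node a A B) C)) (node a A (comb a D (node b B C))) := by
  -- Keeping n spare vertices with bare right leaves makes the induction work: each element of D is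
  -- grafted onto one spare vertex of the next longer rule.
  have key : ∀ n, o.Below (comb a D (leftComb a n (node b (node a leaf leaf) leaf)))
      (node a leaf (comb a D (leftComb a n (node b leaf leaf)))) := by
    induction D with
    | nil => exact h
    | cons d D ih =>
      intro n
      have har : ∀ t : TreeMonomial Op, (leftComb a n t).arity = t.arity + n :=
        arity_leftComb a n
      have h0 := arity_le_arity_comb a D
        (node a (leftComb a n (node b (node a leaf leaf) leaf)) leaf)
      simp only [arity, har] at h0
      have h1 := ih (n + 1)
      rw [leftComb_succ, leftComb_succ] at h1
      -- On both sides exactly n + 3 leaves precede the right leaf of the topmost spare vertex.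
      have h2 := h1.graft_left (i := n + 3) (by omega) d
      rw [graft_comb _ _ _ _ (by simp only [arity, har]; omega)] at h2
      have h3 : (node a leaf (comb a D (node a (leftComb a n (node b leaf leaf)) leaf))).graft
          (n + 3) d = node a leaf (comb a D (node a (leftComb a n (node b leaf leaf)) d)) := by
        rw [graft, if_neg (by simp [arity]),
          graft_comb _ _ _ _ (by simp only [arity, har]; omega), graft,
          if_neg (by simp only [arity, har]; omega), graft]
      have h4 : (node a (leftComb a n (node b (node a leaf leaf) leaf)) leaf).graft (n + 3) d =
          node a (leftComb a n (node b (node a leaf leaf) leaf)) d := by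
        rw [graft, if_neg (by simp only [arity, har]; omega), graft]
      rw [h3, h4] at h2
      exact h2
  have h0 : o.Below (comb a D (node b (node a leaf leaf) leaf))
      (node a leaf (comb a D (node b leaf leaf))) := key 0
  have hle : ∀ T : TreeMonomial Op, T.arity ≤ (comb a D T).arity := arity_le_arity_comb a D
  have s0 := hle (node b (node a leaf leaf) leaf)
  have s1 := hle (node b (node a leaf leaf) C)
  have s2 := hle (node b (node a leaf B) C)
  have hC := C.arity_pos
  have hB := B.arity_pos
  simp only [arity] at s0 s1 s2
  -- C, B, A are grafted from right to left, so the leaf numbers still to be used do not shift.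
  have h1 := h0.graft_left (i := 2) (by omega) C
  rw [graft_comb _ _ _ _ (by simp [arity])] at h1
  simp only [graft, arity] at h1
  norm_num at h1
  rw [graft_comb _ _ _ _ (by simp [arity])] at h1
  simp only [graft, arity] at h1
  norm_num at h1
  have h2 := h1.graft_left (i := 1) (by omega) B
  rw [graft_comb _ _ _ _ (by simp only [arity]; omega)] at h2
  simp only [graft, arity] at h2
  norm_num at h2
  rw [graft_comb _ _ _ _ (by simp [arity])] at h2
  simp only [graft, arity] at h2
  norm_num at h2
  have h3 := h2.graft_left (i := 0) (by omega) A
  rw [graft_comb _ _ _ _ (by simp [arity])] at h3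
  simpa [graft, arity] using h3

/-- After one rule instance, what remains is `mul` into the smaller tree B; hence the induction on
arity. -/
theorem mul_eq_or_below (h : ∀ a b n, a ≠ b → o.Below (ruleRhs a b n) (ruleLhs a b n)) (a : Op)
    (A R : TreeMonomial Op) : mul a A R = node a A R ∨ o.Below (mul a A R) (node a A R) := by
  induction hn : R.arity using Nat.strong_induction_on generalizing R with
  | _ n ih =>
    by_cases hs : SpineAll a R
    · exact .inl (mul_of_spineAll A hs)
    · obtain ⟨D, b, B, C, hb, rfl, h2⟩ := exists_comb_of_not_spineAll hs
      rw [h2]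
      have h3 := below_rule_instance (fun n => h a b n hb) D A B C
      have h4 : B.arity < n := by
        have := arity_le_arity_comb a D (node b B C)
        have := C.arity_pos
        simp only [arity] at *
        omega
      refine .inr ?_
      rcases ih _ h4 B rfl with h5 | h5
      · rwa [h5]
      · exact (Below.comb (h5.node_left b C) a D).trans h3

theorem nf_eq_or_below (h : ∀ a b n, a ≠ b → o.Below (ruleRhs a b n) (ruleLhs a b n))
    (t : TreeMonomial Op) : nf t = t ∨ o.Below (nf t) t := by
  have tr : ∀ {s t u : TreeMonomial Op}, (s = t ∨ o.Below s t) → (t = u ∨ o.Below t u) →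
      (s = u ∨ o.Below s u) := by
    rintro s t u (rfl | h1) (rfl | h2)
    · exact .inl rfl
    · exact .inr h2
    · exact .inr h1
    · exact .inr (h1.trans h2)
  induction t with
  | leaf => exact .inl rfl
  | node a l r hl hr =>
    refine tr (mul_eq_or_below h a (nf l) (nf r)) (tr (t := node a l (nf r)) ?_ ?_)
    · exact hl.imp (fun h => by rw [h]) fun h => h.node_left a _
    · exact hr.imp (fun h => by rw [h]) fun h => h.node_right a _

theorem exists_isLeadingMonomial {X : Type} {o : TreeMonomialOrder X} {n : ℕ} {f : Free k X}
    (hf : f ∈ component k X n) (h0 : f ≠ 0) : ∃ t, IsLeadingMonomial o f t := by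
  have har : ∀ t ∈ f.support, t.arity = n := fun t ht => hf ht
  have key : ∀ S : Finset (TreeMonomial X), S.Nonempty → (∀ t ∈ S, t.arity = n) →
      ∃ t ∈ S, ∀ s ∈ S, s ≠ t → o.lt s t := by
    intro S hS
    induction hS using Finset.Nonempty.cons_induction with
    | singleton a => intro _; exact ⟨a, by simp, by simp⟩
    | cons a S ha hS ih =>
      intro hn
      obtain ⟨t, ht, hmax⟩ := ih fun t ht => hn t (Finset.mem_cons_of_mem ht)
      have ha' := hn a (Finset.mem_cons_self a S)
      have ht' := hn t (Finset.mem_cons_of_mem ht)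
      rcases o.lt_trichotomy (ha'.trans ht'.symm) with h | h | h
      · refine ⟨t, Finset.mem_cons_of_mem ht, fun s hs hne => ?_⟩
        rcases Finset.mem_cons.1 hs with rfl | hs
        · exact h
        · exact hmax s hs hne
      · exact absurd (h ▸ ht) ha
      · refine ⟨a, Finset.mem_cons_self a S, fun s hs hne => ?_⟩
        rcases Finset.mem_cons.1 hs with rfl | hs
        · exact absurd rfl hne
        · by_cases hst : s = t
          · rwa [hst]
          · exact o.lt_trans (by rw [hn s (Finset.mem_cons_of_mem hs), ht'])
              (by rw [ha', ht']) (hmax s hs hst) h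
  exact key f.support (Finsupp.support_nonempty_iff.2 h0) har

end Order

/-! ### The ideal, the kernel of `nf`, and the Gröbner property -/

section Ideal

variable {k : Type*} [Field k]

theorem pcomp_mem_component {X : Type} {m n i : ℕ} {f g : Free k X}
    (hf : f ∈ component k X m) (hg : g ∈ component k X n) :
    pcomp f i g ∈ component k X (m + n - 1) := by
  refine Submodule.sum_mem _ fun s hs => Submodule.sum_mem _ fun t ht => ?_
  refine Finsupp.single_mem_supported k _ ?_
  have h1 : s.arity = m := hf hs
  have h2 : t.arity = n := hg ht
  simp only [Set.mem_ofPred_eq, arity_graft, h1, h2]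

theorem mapDomain_pcomp (f : Free k Op) (i : ℕ) (g : Free k Op) :
    Finsupp.mapDomain nf (pcomp f i g) =
      f.sum fun s a => g.sum fun t b => Finsupp.single (nf (s.graft i t)) (a * b) := by
  simp only [pcomp, Finsupp.sum, Finsupp.mapDomain_finsetSum, Finsupp.mapDomain_single]

/-- With its counterpart on the right, this makes the kernel of `nf` closed under composition: the
normal form of a graft depends only on the normal forms of its factors. -/
theorem mapDomain_pcomp_left (f : Free k Op) (i : ℕ) (g : Free k Op) :
    Finsupp.mapDomain nf (pcomp (Finsupp.mapDomain nf f) i g) =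
      Finsupp.mapDomain nf (pcomp f i g) := by
  rw [mapDomain_pcomp, mapDomain_pcomp, Finsupp.sum_mapDomain_index]
  · simp only [nf_graft_nf_left]
  · simp
  · intro s a b
    simp [add_mul, Finsupp.sum_add]

theorem mapDomain_pcomp_right (f : Free k Op) (i : ℕ) (g : Free k Op) :
    Finsupp.mapDomain nf (pcomp f i (Finsupp.mapDomain nf g)) =
      Finsupp.mapDomain nf (pcomp f i g) := by
  rw [mapDomain_pcomp, mapDomain_pcomp]
  refine Finsupp.sum_congr fun s _ => ?_
  rw [Finsupp.sum_mapDomain_index]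
  · simp only [nf_graft_nf_right]
  · simp
  · intro t a b
    simp [mul_add]

/-- The combinations of tree monomials of arity `n` that vanish after replacing each monomial by
its normal form. -/
def nfKernel (k : Type*) [Field k] (n : ℕ) : Submodule k (Free k Op) :=
  component k Op n ⊓ LinearMap.ker (Finsupp.lmapDomain k k nf)

theorem mem_nfKernel {n : ℕ} {f : Free k Op} :
    f ∈ nfKernel k n ↔ f ∈ component k Op n ∧ Finsupp.mapDomain nf f = 0 := Iff.rfl

theorem isOperadIdeal_nfKernel : IsOperadIdeal (nfKernel k) where
  le_component _ := inf_le_left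
  comp_left m n i f g _ hf hg := by
    rw [mem_nfKernel] at hf ⊢
    refine ⟨pcomp_mem_component hf.1 hg, ?_⟩
    rw [← mapDomain_pcomp_left, hf.2]
    simp [pcomp]
  comp_right m n i f g _ hf hg := by
    rw [mem_nfKernel] at hg ⊢
    refine ⟨pcomp_mem_component hf hg.1, ?_⟩
    rw [← mapDomain_pcomp_right, hg.2]
    simp [pcomp]

theorem bicomIdeal_le_nfKernel (n : ℕ) : bicomIdeal k n ≤ nfKernel k n := by
  refine sInf_le ⟨nfKernel k, isOperadIdeal_nfKernel, ?_, rfl⟩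
  intro r hr m hm
  refine ⟨hm, ?_⟩
  change Finsupp.mapDomain nf r = 0
  have key : ∀ {s t : TreeMonomial Op}, Cong s t →
      Finsupp.mapDomain nf (Finsupp.single s (1 : k) - Finsupp.single t 1) = 0 := by
    intro s t h
    rw [← Finsupp.lmapDomain_apply k k, map_sub, Finsupp.lmapDomain_apply,
      Finsupp.lmapDomain_apply, Finsupp.mapDomain_single, Finsupp.mapDomain_single, h.nf_eq,
      sub_self]
  rcases hr with rfl | rfl
  · exact key (.rel (by simp) _ _ _)
  · exact key (.rel (by simp) _ _ _)

/-- The trees `s` and `t` have the same arity and agree modulo `I`. -/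
def Congruent (I : ℕ → Submodule k (Free k Op)) (s t : TreeMonomial Op) : Prop :=
  s.arity = t.arity ∧ Finsupp.single s (1 : k) - Finsupp.single t 1 ∈ I s.arity

theorem single_mem_component {X : Type} (t : TreeMonomial X) :
    Finsupp.single t (1 : k) ∈ component k X t.arity :=
  Finsupp.single_mem_supported k _ rfl

theorem Congruent.symm {I : ℕ → Submodule k (Free k Op)} {s t : TreeMonomial Op}
    (h : Congruent I s t) : Congruent I t s :=
  ⟨h.1.symm, by rw [← h.1, ← neg_sub]; exact neg_mem h.2⟩

theorem Congruent.trans {I : ℕ → Submodule k (Free k Op)} {s t u : TreeMonomial Op}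
    (h : Congruent I s t) (h' : Congruent I t u) : Congruent I s u :=
  ⟨h.1.trans h'.1, by
    rw [← sub_add_sub_cancel _ (Finsupp.single t (1 : k))]
    exact add_mem h.2 (by rw [h.1]; exact h'.2)⟩

theorem pcomp_sub_left {X : Type} (f f' : Free k X) (i : ℕ) (g : Free k X) :
    pcomp (f - f') i g = pcomp f i g - pcomp f' i g := by
  refine Finsupp.sum_sub_index fun s a b => ?_
  simp [sub_mul, Finsupp.sum, Finset.sum_sub_distrib]

theorem pcomp_sub_right {X : Type} (f : Free k X) (i : ℕ) (g g' : Free k X) :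
    pcomp f i (g - g') = pcomp f i g - pcomp f i g' := by
  unfold pcomp
  rw [← Finsupp.sum_sub]
  refine Finsupp.sum_congr fun s _ => Finsupp.sum_sub_index fun t a b => ?_
  simp [mul_sub]

theorem pcomp_single_single {X : Type} (s t : TreeMonomial X) (i : ℕ) :
    pcomp (Finsupp.single s (1 : k)) i (Finsupp.single t 1) =
      Finsupp.single (s.graft i t) 1 := by
  simp [pcomp, -Finsupp.single_mul]

theorem Congruent.graft_left {I : ℕ → Submodule k (Free k Op)} (hI : IsOperadIdeal I)
    {s s' : TreeMonomial Op} (h : Congruent I s s') (i : ℕ) (t : TreeMonomial Op)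
    (hi : i < s.arity) : Congruent I (s.graft i t) (s'.graft i t) := by
  refine ⟨by rw [arity_graft, arity_graft, h.1], ?_⟩
  have := hI.comp_left _ _ i _ _ hi h.2 (single_mem_component t)
  rwa [pcomp_sub_left, pcomp_single_single, pcomp_single_single, ← arity_graft _ _ i] at this

theorem Congruent.graft_right {I : ℕ → Submodule k (Free k Op)} (hI : IsOperadIdeal I)
    {t t' : TreeMonomial Op} (h : Congruent I t t') (i : ℕ) (s : TreeMonomial Op)
    (hi : i < s.arity) : Congruent I (s.graft i t) (s.graft i t') := by
  refine ⟨by rw [arity_graft, arity_graft, h.1], ?_⟩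
  have := hI.comp_right _ _ i _ _ hi (single_mem_component s) h.2
  rwa [pcomp_sub_right, pcomp_single_single, pcomp_single_single, ← arity_graft _ _ i] at this

/-- Stated for an arbitrary ideal containing the relations, since the generated ideal is the
intersection of all of these. -/
theorem Cong.congruent {I : ℕ → Submodule k (Free k Op)} (hI : IsOperadIdeal I)
    (hR : ∀ r ∈ bicomRelations k, ∀ m, r ∈ component k Op m → r ∈ I m) {s t : TreeMonomial Op}
    (h : Cong s t) : Congruent I s t := by
  induction h with
  | refl t => exact ⟨rfl, by rw [sub_self]; exact zero_mem _⟩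
  | symm _ ih => exact ih.symm
  | trans _ _ h1 h2 => exact h1.trans h2
  | @node a l r l' r' _ _ h1 h2 =>
    have h3 := h1.graft_right hI 0 (TreeMonomial.node a leaf r) (by simp [arity])
    have h4 := h2.graft_right hI l'.arity (TreeMonomial.node a l' leaf) (by simp [arity])
    simp only [graft, arity, Nat.lt_irrefl, if_false, zero_lt_one, if_true] at h3 h4
    exact h3.trans h4
  | @rel a b hab A B C =>
    have h0 : Congruent I (TreeMonomial.node a leaf (TreeMonomial.node b leaf leaf))
        (TreeMonomial.node b (TreeMonomial.node a leaf leaf) leaf) := by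
      refine ⟨rfl, hR _ ?_ _ ?_⟩
      · cases a <;> cases b <;> simp [bicomRelations] at hab ⊢
      · exact sub_mem (single_mem_component (k := k) (TreeMonomial.node a leaf (.node b leaf leaf)))
          (single_mem_component (k := k) (TreeMonomial.node b (.node a leaf leaf) leaf))
    have hC := C.arity_pos
    have hB := B.arity_pos
    have h1 := h0.graft_left hI 2 C (by simp [arity])
    norm_num [graft, arity] at h1
    have h2 := h1.graft_left hI 1 B (by simp [arity])
    norm_num [graft, arity] at h2
    have h3 := h2.graft_left hI 0 A (by simp [arity])
    simpa [graft, arity] using h3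

theorem ruleElement_mem_bicomIdeal {a b : Op} (h : a ≠ b) (n : ℕ) :
    ruleElement k a b n ∈ bicomIdeal k (ruleLhs a b n).arity := by
  refine Submodule.mem_sInf.2 ?_
  rintro _ ⟨I, hI, hR, rfl⟩
  exact ((cong_rule h n).congruent hI hR).2

theorem isGroebnerBasis_of_orientsRules {o : TreeMonomialOrder Op} (ho : OrientsRules k o) :
    IsGroebnerBasis o (Set.range (bicomF k) ∪ Set.range (bicomG k)) (bicomIdeal k) := by
  constructor
  · rintro g (⟨n, rfl⟩ | ⟨n, rfl⟩)
    · exact ⟨_, ruleElement_mem_bicomIdeal (by simp) n⟩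
    · exact ⟨_, ruleElement_mem_bicomIdeal (by simp) n⟩
  · intro n f hf h0
    obtain ⟨hc, hk⟩ := mem_nfKernel.1 (bicomIdeal_le_nfKernel n hf)
    obtain ⟨t, ht⟩ := exists_isLeadingMonomial (o := o) hc h0
    by_contra hcon
    have hnf : nf t = t := by
      refine nf_eq_self fun a b m hab hd => hcon ?_
      cases a <;> cases b
      · exact absurd rfl hab
      · exact ⟨_, .inl ⟨m, rfl⟩, _, t, (ho m).1, ht, hd⟩
      · exact ⟨_, .inr ⟨m, rfl⟩, _, t, (ho m).2, ht, hd⟩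
      · exact absurd rfl hab
    -- No other s in the support contributes at t, because nf s ≤ s < t.
    have hcoef : Finsupp.mapDomain nf f t = f t := by
      classical
      rw [Finsupp.mapDomain, Finsupp.sum_apply, Finsupp.sum, Finset.sum_eq_single t]
      · rw [hnf, Finsupp.single_eq_same]
      · intro s hs hne
        refine Finsupp.single_eq_of_ne fun hst => ?_
        have hlt := ht.2 s hs hne
        have har : s.arity = t.arity := (hc hs : s.arity = n).trans (hc ht.1 : t.arity = n).symm
        rcases nf_eq_or_below (fun a b n hab => ho.below hab n) s with h | h
        · exact hne (by rw [← h, ← hst])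
        · rw [← hst] at h
          exact o.lt_irrefl s (o.lt_trans har har.symm hlt h.2)
      · intro h; exact absurd ht.1 h
    rw [hk] at hcoef
    exact Finsupp.mem_support_iff.1 ht.1 hcoef.symm

end Ideal

/-! ### A monomial order orienting the rules -/

section Existence

/-- The depths of the leaves, listed from the rightmost leaf to the leftmost one; the root has
depth `d`. -/
def depths {X : Type} : ℕ → TreeMonomial X → List ℕ
  | d, leaf => [d]
  | d, node _ l r => depths (d + 1) r ++ depths (d + 1) l

/-- The labels of the internal vertices in prefix order, as numbers. -/
def labels : TreeMonomial Op → List ℕ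
  | leaf => []
  | node a l r => (match a with | x => 0 | y => 1) :: (labels l ++ labels r)

/-- The underlying unlabelled trees agree. -/
inductive SameShape {X : Type} : TreeMonomial X → TreeMonomial X → Prop
  | leaf : SameShape leaf leaf
  | node (a b) {l r l' r'} : SameShape l l' → SameShape r r' → SameShape (node a l r) (node b l' r')

variable {X : Type}

theorem length_depths (d : ℕ) (t : TreeMonomial X) : (depths d t).length = t.arity := by
  induction t generalizing d with
  | leaf => rfl
  | node a l r hl hr => simp only [depths, List.length_append, hl, hr, arity, Nat.add_comm]

theorem depths_add (d e : ℕ) (t : TreeMonomial X) :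
    depths (d + e) t = (depths e t).map (d + ·) := by
  induction t generalizing e with
  | leaf => rfl
  | node a l r hl hr => simp only [depths, List.map_append, Nat.add_assoc, hl, hr]

theorem le_of_depths_eq_cons (t : TreeMonomial X) (d e : ℕ) (u w : List ℕ)
    (h : depths d t ++ u = e :: w) : d ≤ e := by
  induction t generalizing d u with
  | leaf => simp only [depths, List.singleton_append, List.cons.injEq] at h; exact h.1.le
  | node a l r hl hr =>
    rw [depths, List.append_assoc] at h
    exact le_trans (Nat.le_succ d) (hr _ _ h)

/-- Depth lists form a prefix code: at root depth d a leaf gives d, while a node gives a first entry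
of at least d + 1. The tails u and v carry the induction through concatenations. -/
theorem sameShape_of_depths {s t : TreeMonomial X} {d : ℕ} {u v : List ℕ}
    (h : depths d s ++ u = depths d t ++ v) : SameShape s t ∧ u = v := by
  induction s generalizing t d u v with
  | leaf =>
    cases t with
    | leaf => simpa [depths, SameShape.leaf] using h
    | node b l r =>
      rw [depths, depths, List.append_assoc] at h
      exact absurd (le_of_depths_eq_cons r (d + 1) d _ _ h.symm) (by omega)
  | node a l r hl hr =>
    cases t with
    | leaf =>
      rw [depths, depths, List.append_assoc] at h
      exact absurd (le_of_depths_eq_cons r (d + 1) d _ _ h) (by omega)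
    | node b l' r' =>
      simp only [depths, List.append_assoc] at h
      obtain ⟨h1, h2⟩ := hr h
      obtain ⟨h3, h4⟩ := hl h2
      exact ⟨.node a b h3 h1, h4⟩

theorem SameShape.arity_eq {s t : TreeMonomial X} (h : SameShape s t) : s.arity = t.arity := by
  induction h with
  | leaf => rfl
  | node a b _ _ h1 h2 => simp only [arity, h1, h2]

theorem SameShape.depths_eq {s t : TreeMonomial X} (h : SameShape s t) (d : ℕ) :
    depths d s = depths d t := by
  induction h generalizing d with
  | leaf => rfl
  | node a b _ _ h1 h2 => simp only [depths, h1, h2]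

theorem SameShape.refl (t : TreeMonomial X) : SameShape t t := by
  induction t with
  | leaf => exact .leaf
  | node a l r hl hr => exact .node a a hl hr

theorem SameShape.graft {s s' t t' : TreeMonomial X} (h : SameShape s s') (h' : SameShape t t')
    (i : ℕ) : SameShape (s.graft i t) (s'.graft i t') := by
  induction h generalizing i with
  | leaf => exact h'
  | node a b hl hr h1 h2 =>
    simp only [TreeMonomial.graft, hl.arity_eq]
    split_ifs
    · exact .node a b (h1 _) hr
    · exact .node a b hl (h2 _)

theorem SameShape.eq_of_labels {s t : TreeMonomial Op} (h : SameShape s t) {u v : List ℕ}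
    (hl : labels s ++ u = labels t ++ v) : s = t ∧ u = v := by
  induction h generalizing u v with
  | leaf => exact ⟨rfl, hl⟩
  | node a b _ _ h1 h2 =>
    simp only [labels, List.cons_append, List.append_assoc, List.cons.injEq] at hl
    obtain ⟨hab, hl⟩ := hl
    obtain ⟨hl1, hl⟩ := h1 hl
    obtain ⟨hl2, huv⟩ := h2 hl
    subst hl1 hl2
    refine ⟨?_, huv⟩
    cases a <;> cases b <;> first | rfl | exact absurd hab (by decide)

/-- Grafting t replaces the entry m of the chosen leaf by `depths m t`. The list runs from right to
left, so the i leaves on the left form the tail Q. -/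
theorem exists_depths_graft (s : TreeMonomial X) (i d : ℕ) (hi : i < s.arity) :
    ∃ P m Q, Q.length = i ∧ depths d s = P ++ m :: Q ∧
      ∀ t, depths d (s.graft i t) = P ++ (depths m t ++ Q) := by
  induction s generalizing i d with
  | leaf =>
    simp only [arity] at hi
    exact ⟨[], d, [], by simp; omega, rfl, fun t => by simp [graft]⟩
  | node a l r hl hr =>
    simp only [graft]
    split_ifs with h
    · obtain ⟨P, m, Q, h1, h2, h3⟩ := hl i (d + 1) h
      exact ⟨depths (d + 1) r ++ P, m, Q, h1, by simp [depths, h2], fun t => by simp [depths, h3]⟩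
    · simp only [arity] at hi
      obtain ⟨P, m, Q, h1, h2, h3⟩ := hr (i - l.arity) (d + 1) (by omega)
      exact ⟨P, m, Q ++ depths (d + 1) l, by simp [h1, length_depths]; omega,
        by simp [depths, h2], fun t => by simp [depths, h3]⟩

theorem SameShape.length_labels_eq {s t : TreeMonomial Op} (h : SameShape s t) :
    (labels s).length = (labels t).length := by
  induction h with
  | leaf => rfl
  | node a b _ _ h1 h2 => simp [labels, h1, h2]

/-- The labels of t enter the prefix word at a position determined by the shape and i alone, hence
the same for s and s'. -/
theorem SameShape.exists_labels_graft {s s' : TreeMonomial Op} (h : SameShape s s') (i : ℕ) :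
    ∃ P Q P' Q', P.length = P'.length ∧ labels s = P ++ Q ∧ labels s' = P' ++ Q' ∧
      (∀ t, labels (s.graft i t) = P ++ (labels t ++ Q)) ∧
      ∀ t, labels (s'.graft i t) = P' ++ (labels t ++ Q') := by
  induction h generalizing i with
  | leaf => exact ⟨[], [], [], [], by simp [TreeMonomial.graft, labels]⟩
  | @node a b l r l' r' hl hr h1 h2 =>
    simp only [TreeMonomial.graft, hl.arity_eq]
    split_ifs
    · obtain ⟨P, Q, P', Q', e1, e2, e3, e4, e5⟩ := h1 i
      exact ⟨_ :: P, Q ++ labels r, _ :: P', Q' ++ labels r', by simp [e1],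
        by simp [labels, e2]; rfl, by simp [labels, e3]; rfl,
        fun t => by simp [labels, e4], fun t => by simp [labels, e5]⟩
    · obtain ⟨P, Q, P', Q', e1, e2, e3, e4, e5⟩ := h2 (i - l'.arity)
      exact ⟨_ :: (labels l ++ P), Q, _ :: (labels l' ++ P'), Q', by simp [e1, hl.length_labels_eq],
        by simp [labels, e2]; rfl, by simp [labels, e3]; rfl,
        fun t => by simp [labels, e4], fun t => by simp [labels, e5]⟩

theorem append_lt_append_iff_of_length_eq {P P' Q Q' : List ℕ} (h : P.length = P'.length) :
    P ++ Q < P' ++ Q' ↔ P < P' ∨ P = P' ∧ Q < Q' := by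
  induction P generalizing P' with
  | nil =>
    obtain rfl : P' = [] := by simpa using h.symm
    simp
  | cons p P ih =>
    cases P' with
    | nil => simp at h
    | cons p' P' =>
      have h' : P.length = P'.length := by simpa using h
      simp only [List.cons_append, List.cons_lt_cons_iff, ih h', List.cons.injEq]
      tauto

theorem map_add_lt_map_add {u v : List ℕ} (d : ℕ) (h : u < v) :
    u.map (d + ·) < v.map (d + ·) := by
  induction u generalizing v with
  | nil =>
    cases v with
    | nil => exact absurd h (by simp)
    | cons => simp
  | cons p u ih =>
    cases v with
    | nil => exact absurd h (by simp)
    | cons q v =>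
      simp only [List.map_cons, List.cons_lt_cons_iff] at h ⊢
      rcases h with h | ⟨rfl, h⟩
      · exact .inl (by omega)
      · exact .inr ⟨rfl, ih h⟩

theorem depths_lt_depths_of_lt {m m' : ℕ} (h : m < m') (t : TreeMonomial X) :
    depths m t < depths m' t := by
  induction t generalizing m m' with
  | leaf => simpa [depths, List.cons_lt_cons_iff] using h
  | node a l r hl hr =>
    exact (append_lt_append_iff_of_length_eq (by simp only [length_depths])).2
      (.inl (hr (by omega)))

theorem depths_lt_depths {s t : TreeMonomial X} (h : depths 0 s < depths 0 t) (d : ℕ) :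
    depths d s < depths d t := by
  rw [← Nat.add_zero d, depths_add d 0, depths_add d 0]
  exact map_add_lt_map_add d h

/-- Comparison of the leaf depths from right to left, then of the labels. -/
def DepthLt (s t : TreeMonomial Op) : Prop :=
  depths 0 s < depths 0 t ∨ depths 0 s = depths 0 t ∧ labels s < labels t

/-- Bounding the arity instead of fixing it lets one induction hypothesis serve both subtrees. -/
theorem finite_arity_le (n : ℕ) : {t : TreeMonomial Op | t.arity ≤ n}.Finite := by
  have hOp : Finite Op := Finite.of_surjective (fun b : Bool => if b then x else y) fun a => by
    cases a
    · exact ⟨true, rfl⟩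
    · exact ⟨false, rfl⟩
  induction n with
  | zero =>
    refine Set.finite_empty.subset fun t ht => ?_
    have := t.arity_pos
    simp only [Set.mem_ofPred_eq] at ht
    omega
  | succ n ih =>
    refine (((Set.finite_univ (α := Op)).prod (ih.prod ih)).image
      (fun p => node p.1 p.2.1 p.2.2) |>.insert leaf).subset ?_
    intro t ht
    cases t with
    | leaf => exact .inl rfl
    | node a l r =>
      have := l.arity_pos
      have := r.arity_pos
      simp only [Set.mem_ofPred_eq, arity] at ht
      exact .inr ⟨(a, l, r), ⟨trivial, by simp only [Set.mem_ofPred_eq]; omega,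
        by simp only [Set.mem_ofPred_eq]; omega⟩, rfl⟩

theorem depthLt_trichotomy (s t : TreeMonomial Op) : DepthLt s t ∨ s = t ∨ DepthLt t s := by
  rcases lt_trichotomy (depths 0 s) (depths 0 t) with h | h | h
  · exact .inl (.inl h)
  · rcases lt_trichotomy (labels s) (labels t) with h' | h' | h'
    · exact .inl (.inr ⟨h, h'⟩)
    · refine .inr (.inl ?_)
      have hs := (sameShape_of_depths (u := []) (v := []) (by simpa using h)).1
      exact (hs.eq_of_labels (u := []) (v := []) (by simpa using h')).1
    · exact .inr (.inr (.inr ⟨h.symm, h'⟩))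
  · exact .inr (.inr (.inl h))

/-- The monomial order given by comparing the leaf depths from right to left, then the labels. -/
def depthOrder : TreeMonomialOrder Op where
  lt := DepthLt
  isWellOrder n := by
    have hfin : Finite {t : TreeMonomial Op // t.arity = n} :=
      ((finite_arity_le n).subset fun t ht => le_of_eq ht).to_subtype
    let r : {t : TreeMonomial Op // t.arity = n} → {t : TreeMonomial Op // t.arity = n} → Prop :=
      fun s t => DepthLt s.1 t.1
    have htrans : IsTrans _ r := ⟨by
      rintro s t u (h | ⟨h1, h2⟩) (h' | ⟨h1', h2'⟩)
      · exact .inl (h.trans h')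
      · exact .inl (h1' ▸ h)
      · exact .inl (h1 ▸ h')
      · exact .inr ⟨h1.trans h1', h2.trans h2'⟩⟩
    have hirr : Std.Irrefl r := ⟨by
      rintro s (h | ⟨-, h⟩)
      · exact _root_.lt_irrefl _ h
      · exact _root_.lt_irrefl _ h⟩
    have htri : Std.Trichotomous r := ⟨fun s t h1 h2 => by
      rcases depthLt_trichotomy s.1 t.1 with h | h | h
      · exact absurd h h1
      · exact Subtype.ext h
      · exact absurd h h2⟩
    have hwf : IsWellFounded _ r := ⟨Finite.wellFounded_of_trans_of_irrefl r⟩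
    exact {}
  graft_left s s' t i har hi h := by
    rcases h with h | ⟨h, h'⟩
    · obtain ⟨P, m, Q, e1, e2, e3⟩ := exists_depths_graft s i 0 hi
      obtain ⟨P', m', Q', e1', e2', e3'⟩ := exists_depths_graft s' i 0 (har ▸ hi)
      have hlen : P.length = P'.length := by
        have h1 := congrArg List.length e2
        have h2 := congrArg List.length e2'
        simp only [length_depths, List.length_append, List.length_cons] at h1 h2
        omega
      have hm : ∀ n, (depths n t).length = t.arity := fun n => length_depths n t
      refine .inl ?_
      rw [e2, e2', append_lt_append_iff_of_length_eq hlen, List.cons_lt_cons_iff] at h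
      rw [e3, e3', append_lt_append_iff_of_length_eq hlen,
        append_lt_append_iff_of_length_eq (by rw [hm, hm])]
      -- The first difference lies to the right of the i-th leaf, at it, or to its left. In the
      -- middle case a deeper root raises all leaf depths of t.
      rcases h with h | ⟨h, h' | ⟨rfl, h'⟩⟩
      · exact .inl h
      · exact .inr ⟨h, .inl (depths_lt_depths_of_lt h' t)⟩
      · exact .inr ⟨h, .inr ⟨rfl, h'⟩⟩
    -- Equal depths force equal shapes; the grafts then tie on depths too, and the labels decide.
    · have hs := (sameShape_of_depths (u := []) (v := []) (by simpa using h)).1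
      refine .inr ⟨(hs.graft (.refl t) i).depths_eq 0, ?_⟩
      obtain ⟨P, Q, P', Q', e1, e2, e3, e4, e5⟩ := hs.exists_labels_graft i
      rw [e2, e3, append_lt_append_iff_of_length_eq e1] at h'
      rw [e4, e5, append_lt_append_iff_of_length_eq e1, append_lt_append_iff_of_length_eq rfl]
      exact h'.imp_right fun h => ⟨h.1, .inr ⟨rfl, h.2⟩⟩
  graft_right s t t' i har hi h := by
    rcases h with h | ⟨h, h'⟩
    · obtain ⟨P, m, Q, e1, e2, e3⟩ := exists_depths_graft s i 0 hi
      refine .inl ?_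
      rw [e3, e3, append_lt_append_iff_of_length_eq rfl,
        append_lt_append_iff_of_length_eq (by simp only [length_depths, har])]
      exact .inr ⟨rfl, .inl (depths_lt_depths h m)⟩
    · have hs := (sameShape_of_depths (u := []) (v := []) (by simpa using h)).1
      refine .inr ⟨((SameShape.refl s).graft hs i).depths_eq 0, ?_⟩
      obtain ⟨P, Q, P', Q', e1, e2, e3, e4, e5⟩ := (SameShape.refl s).exists_labels_graft i
      rw [e4, e4, append_lt_append_iff_of_length_eq rfl,
        append_lt_append_iff_of_length_eq hs.length_labels_eq]
      exact .inr ⟨rfl, .inl h'⟩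

/-- The first entry, the depth of the rightmost leaf, already decides: 1 against 2. -/
theorem depthLt_rule (a b : Op) (n : ℕ) : DepthLt (ruleRhs a b n) (ruleLhs a b n) := by
  refine .inl ?_
  cases n with
  | zero => simp [ruleLhs, ruleRhs, leftComb, depths, List.cons_lt_cons_iff]
  | succ n => simp [ruleLhs, ruleRhs, leftComb_succ, depths, List.cons_lt_cons_iff]

theorem orientsRules_depthOrder (k : Type*) [Field k] : OrientsRules k depthOrder := by
  have key : ∀ {a b : Op}, a ≠ b → ∀ n,
      IsLeadingMonomial depthOrder (ruleElement k a b n) (ruleLhs a b n) := by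
    classical
    intro a b hab n
    refine ⟨by simp [ruleElement, ruleLhs_ne_ruleRhs hab n], fun s hs hne => ?_⟩
    obtain rfl : s = ruleRhs a b n := by
      by_contra hne'
      simp [ruleElement, Ne.symm hne, Ne.symm hne'] at hs
    exact depthLt_rule a b n
  exact fun n => ⟨key (by simp) n, key (by simp) n⟩

end Existence

end NSOperad

end

theorem mainTheorem6 (k : Type*) [Field k] :
    (∃ o : NSOperad.TreeMonomialOrder NSOperad.Op, NSOperad.OrientsRules k o) ∧
    ∀ o : NSOperad.TreeMonomialOrder NSOperad.Op, NSOperad.OrientsRules k o →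
      NSOperad.IsGroebnerBasis o
        (Set.range (NSOperad.bicomF k) ∪ Set.range (NSOperad.bicomG k))
        (NSOperad.bicomIdeal k) :=
  ⟨⟨NSOperad.depthOrder, NSOperad.orientsRules_depthOrder k⟩,
    fun _ ho => NSOperad.isGroebnerBasis_of_orientsRules ho⟩
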